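/- Notation. Let $G$ be a profinite group and write $H^i(G)=H^i(G,\mathbb{Z}/2)$ for profinite (continuous) cohomology with trivial action; thus $H^1(G)$ is the group of continuous homomorphisms $G\to\mathbb{Z}/2$. Let $\beta_G\colon H^1(G)\to H^2(G)$ be the Bockstein homomorphism, i.e. the connecting map of the exact sequence $0\to\mathbb{Z}/2\to\mathbb{Z}/4\to\mathbb{Z}/2\to0$. For $p=q=2$ one says that $G$ has Galois relation type if (i) the kernel of the homomorphism $\cup\colon H^1(G)\otimes_{\mathbb{Z}}H^1(G)\to H^2(G)$ induced by the cup product is generated by elements of the form $\psi\otimes\psi'$ with $\psi,\psi'\in H^1(G)$; and (ii) there exists $\xi\in H^1(G)$ such that $\psi\cup\xi+\beta_G(\psi)=0$ for every $\psi\in H^1(G)$. (For a general prime power $q=p^d$ one uses coefficients $\mathbb{Z}/q$ and the sequence $0\to\mathbb{Z}/q\to\mathbb{Z}/q^2\to\mathbb{Z}/q\to0$, and also requires that (iii) $H^1(G,\mathbb{Z}/q)\to H^1(G,\mathbb{Z}/p^i)$ is surjective for $1\le i\le d$; this is automatic when $q=p$.) The descending $2$-central sequence of $G$ is defined by $G^{(1)}=G$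 and $G^{(i+1)}=(G^{(i)})^2[G^{(i)},G]$, the closed subgroup generated by all $h^2$ and all $[h,g]=h^{-1}g^{-1}hg$ with $h\in G^{(i)}$, $g\in G$. Let $G(2)$ be the maximal pro-$2$ quotient of $G$, and let $D_4$ be the dihedral group of order $8$. Corollary 11.4. Let $G$ be a profinite group of Galois relation type (for $p=q=2$) such that $G(2)\not\cong\mathbb{Z}/2$. Then $G^{(3)}$ is the intersection of all normal open subgroups $N$ of $G$ such that $G/N$ is isomorphic to one of the groups $1$, $\mathbb{Z}/4$, $D_4$. -/

import Mathlib

open scoped TensorProduct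

namespace ProfiniteCohomology

section Cochains

variable (q : ℕ) (G : Type*) [Group G] [TopologicalSpace G] [IsTopologicalGroup G]

/-- The group `H¹(G, ℤ/q)` for the trivial action: continuous homomorphisms `G → ℤ/q`
(the 1-cocycles; 1-coboundaries vanish because the action is trivial). -/
def H1 : AddSubgroup C(G, ZMod q) where
  carrier := {f | ∀ σ τ, f (σ * τ) = f σ + f τ}
  add_mem' := by
    intro f g hf hg σ τ
    simp only [ContinuousMap.add_apply, hf σ τ, hg σ τ]
    abel
  zero_mem' := by intro σ τ; simp
  neg_mem' := by
    intro f hf σ τ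
    simp only [ContinuousMap.neg_apply, hf σ τ]
    abel

/-- The inhomogeneous differential `C¹ → C²` on continuous cochains with values in the trivial
module `ℤ/q`, namely `(d c)(σ, τ) = c(σ) + c(τ) - c(στ)`. -/
def d1 : C(G, ZMod q) →+ C(G × G, ZMod q) where
  toFun c := ⟨fun x => c x.1 + c x.2 - c (x.1 * x.2), by fun_prop⟩
  map_zero' := by ext x; simp
  map_add' := by
    intro c c'
    ext x
    simp only [ContinuousMap.coe_mk, ContinuousMap.add_apply]
    abel

/-- Continuous inhomogeneous 2-cocycles with values in the trivial module `ℤ/q`. -/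
def Z2 : AddSubgroup C(G × G, ZMod q) where
  carrier := {f | ∀ σ τ ρ, f (τ, ρ) - f (σ * τ, ρ) + f (σ, τ * ρ) - f (σ, τ) = 0}
  add_mem' := by
    intro f g hf hg σ τ ρ
    simp only [ContinuousMap.add_apply]
    linear_combination hf σ τ ρ + hg σ τ ρ
  zero_mem' := by intro σ τ ρ; simp
  neg_mem' := by
    intro f hf σ τ ρ
    simp only [ContinuousMap.neg_apply]
    linear_combination - hf σ τ ρ

/-- The profinite (continuous) cohomology group `H²(G, ℤ/q)` for the trivial action:
continuous 2-cocycles modulo the coboundaries of continuous 1-cochains. -/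
abbrev H2 : Type _ := Z2 q G ⧸ (d1 q G).range.addSubgroupOf (Z2 q G)

variable {q G}

/-- The class in `H²(G, ℤ/q)` of a continuous 2-cocycle. -/
def H2.mk : Z2 q G →+ H2 q G := QuotientAddGroup.mk' _

/-- The 2-cocycle `(σ, τ) ↦ ψ(σ) ψ'(τ)` that represents the cup product `ψ ∪ ψ'`. -/
def cupCocycle (ψ ψ' : H1 q G) : Z2 q G :=
  ⟨⟨fun x => ψ.1 x.1 * ψ'.1 x.2, by fun_prop⟩, by
    intro σ τ ρ
    simp only [ContinuousMap.coe_mk, ψ.2 σ τ, ψ'.2 τ ρ]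
    ring⟩

variable (q G) in
/-- The cup product `H¹(G, ℤ/q) × H¹(G, ℤ/q) → H²(G, ℤ/q)` as a biadditive map. -/
def cup : H1 q G →+ H1 q G →+ H2 q G :=
  AddMonoidHom.mk' (fun ψ => AddMonoidHom.mk' (fun ψ' => H2.mk (cupCocycle ψ ψ')) (by
    intro a b
    rw [← map_add]
    congr 1
    ext x
    exact mul_add _ _ _)) (by
    intro a b
    ext ψ'
    simp only [AddMonoidHom.mk'_apply, AddMonoidHom.add_apply]
    rw [← map_add]
    congr 1
    ext x
    exact add_mul _ _ _)

variable (q G) in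
/-- The homomorphism `H¹(G, ℤ/q) ⊗_ℤ H¹(G, ℤ/q) → H²(G, ℤ/q)` induced by the cup product. -/
noncomputable def cupTensor : (H1 q G) ⊗[ℤ] (H1 q G) →+ H2 q G :=
  TensorProduct.liftAddHom (cup q G) (by
    intro n ψ ψ'
    simp only [map_zsmul]
    rfl)

/-- The map `H¹(G, ℤ/q) → H¹(G, ℤ/m)` induced by the projection `ℤ/q → ℤ/m`, for `m ∣ q`. -/
def H1.reduce {m : ℕ} (h : m ∣ q) (ψ : H1 q G) : H1 m G :=
  ⟨⟨fun σ => ZMod.castHom h (ZMod m) (ψ.1 σ),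
      (continuous_of_discreteTopology (f := ZMod.castHom h (ZMod m))).comp ψ.1.continuous⟩, by
    intro σ τ
    simp only [ContinuousMap.coe_mk, ψ.2 σ τ, map_add]⟩

/-- The carry of the addition of residues: `q · carry a b = ã + b̃ - (a + b)~`, where `ã` is the
representative of `a` in `{0, …, q - 1}`. -/
def carry (a b : ZMod q) : ℕ := (a.val + b.val) / q

lemma carry_spec [NeZero q] (a b : ZMod q) : a.val + b.val = (a + b).val + q * carry a b := by
  rw [ZMod.val_add, carry, Nat.mod_add_div]

lemma carry_cocycle [NeZero q] (a b c : ZMod q) :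
    carry b c + carry a (b + c) = carry (a + b) c + carry a b := by
  have h1 := carry_spec a b
  have h2 := carry_spec b c
  have h3 := carry_spec a (b + c)
  have h4 := carry_spec (a + b) c
  rw [add_assoc] at h4
  refine Nat.eq_of_mul_eq_mul_left (Nat.pos_of_ne_zero (NeZero.ne q)) ?_
  rw [mul_add, mul_add]
  omega

/-- The 2-cocycle `(σ, τ) ↦ (ψ̃(σ) + ψ̃(τ) - ψ̃(στ)) / q`, where `ψ̃ : G → ℤ/q²` is the continuous
lift of `ψ` with values in the classes of `0, …, q - 1`. -/
def bocksteinCocycle [NeZero q] (ψ : H1 q G) : Z2 q G :=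
  ⟨⟨fun x => (carry (ψ.1 x.1) (ψ.1 x.2) : ZMod q),
      (continuous_of_discreteTopology (f := fun y : ZMod q × ZMod q => (carry y.1 y.2 : ZMod q))).comp
        (((ψ.1.continuous.comp continuous_fst)).prodMk (ψ.1.continuous.comp continuous_snd))⟩, by
    intro σ τ ρ
    have h := congrArg (Nat.cast : ℕ → ZMod q) (carry_cocycle (ψ.1 σ) (ψ.1 τ) (ψ.1 ρ))
    simp only [Nat.cast_add] at h
    simp only [ContinuousMap.coe_mk, ψ.2 σ τ, ψ.2 τ ρ]
    linear_combination h⟩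

/-- The Bockstein map `β_G : H¹(G, ℤ/q) → H²(G, ℤ/q)`: the connecting map of the short exact
sequence of trivial modules `0 → ℤ/q → ℤ/q² → ℤ/q → 0`, whose first map is multiplication by `q`. -/
def bockstein [NeZero q] (ψ : H1 q G) : H2 q G := H2.mk (bocksteinCocycle ψ)

/-- `bockstein` is the connecting map: if `c : G → ℤ/q²` is any continuous lift of `ψ`, and `f` is a
2-cocycle whose image under `ℤ/q → ℤ/q²`, `x ↦ q x`, is the coboundary of `c`, then `f` represents
the Bockstein of `ψ`. -/
lemma bockstein_eq_of_lift [NeZero q] (ψ : H1 q G) (c : C(G, ZMod (q * q))) (f : Z2 q G)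
    (hc : ∀ σ, ((c σ).val : ZMod q) = ψ.1 σ)
    (hf : ∀ x, ((q * (f.1 x).val : ℕ) : ZMod (q * q)) = d1 (q * q) G c x) :
    bockstein ψ = H2.mk f := by
  have hq : 0 < q := Nat.pos_of_ne_zero (NeZero.ne q)
  have hqq : NeZero (q * q) := ⟨(Nat.mul_pos hq hq).ne'⟩
  have hval : ∀ σ, (c σ).val = (ψ.1 σ).val + q * ((c σ).val / q) := by
    intro σ
    rw [← hc σ, ZMod.val_natCast, Nat.mod_add_div]
  symm
  refine (QuotientAddGroup.eq_iff_sub_mem).2 ?_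
  rw [AddSubgroup.mem_addSubgroupOf]
  refine ⟨⟨fun σ => (((c σ).val / q : ℕ) : ZMod q),
    (continuous_of_discreteTopology (f := fun y : ZMod (q * q) => ((y.val / q : ℕ) : ZMod q))).comp
      c.continuous⟩, ?_⟩
  ext x
  obtain ⟨σ, τ⟩ := x
  have h := hf (σ, τ)
  have e : (d1 (q * q) G c) (σ, τ) = c σ + c τ - c (σ * τ) := rfl
  rw [e, ← ZMod.natCast_zmod_val (c σ), ← ZMod.natCast_zmod_val (c τ),
    ← ZMod.natCast_zmod_val (c (σ * τ)), eq_sub_iff_add_eq, ← Nat.cast_add, ← Nat.cast_add,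
    ZMod.natCast_eq_natCast_iff, hval σ, hval τ, hval (σ * τ), ψ.2 σ τ] at h
  have h0 := carry_spec (ψ.1 σ) (ψ.1 τ)
  have h1 : (q * ((f.1 (σ, τ)).val + (c (σ * τ)).val / q) ≡
      q * (carry (ψ.1 σ) (ψ.1 τ) + (c σ).val / q + (c τ).val / q) [MOD q * q]) := by
    refine Nat.ModEq.add_left_cancel' ((ψ.1 σ + ψ.1 τ).val) ?_
    convert h using 1
    · ring
    · rw [mul_add, mul_add]; omega
  have h2 := Nat.ModEq.mul_left_cancel' hq.ne' h1
  rw [← ZMod.natCast_eq_natCast_iff] at h2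
  push_cast at h2
  rw [ZMod.natCast_zmod_val] at h2
  change (((c σ).val / q : ℕ) : ZMod q) + (((c τ).val / q : ℕ) : ZMod q)
    - (((c (σ * τ)).val / q : ℕ) : ZMod q)
    = f.1 (σ, τ) - (carry (ψ.1 σ) (ψ.1 τ) : ZMod q)
  linear_combination -h2

end Cochains

/-- Profinite groups of Galois relation type, relative to a prime power `q`. For `q = p ^ d` the
divisors `m` of `q` in the third condition are the `p ^ i` with `i ≤ d` (`m = 1` adds nothing). -/
structure IsGaloisRelationType (q : ℕ) [NeZero q] (G : Type*) [Group G] [TopologicalSpace G]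
    [IsTopologicalGroup G] : Prop where
  /-- The kernel of the cup product on `H¹ ⊗ H¹` is generated by pure tensors. -/
  ker_cup : AddSubgroup.closure
    {x : (H1 q G) ⊗[ℤ] (H1 q G) | x ∈ (cupTensor q G).ker ∧ ∃ ψ ψ' : H1 q G, x = ψ ⊗ₜ[ℤ] ψ'}
      = (cupTensor q G).ker
  /-- The Bockstein map is, up to sign, the cup product with a fixed class. -/
  exists_bockstein : ∃ ξ : H1 q G, ∀ ψ : H1 q G, cup q G ψ ξ + bockstein ψ = 0
  reduce_surjective : ∀ (m : ℕ) (h : m ∣ q), Function.Surjective (H1.reduce (G := G) h)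

end ProfiniteCohomology

section Groups

variable (G : Type*) [Group G] [TopologicalSpace G] [IsTopologicalGroup G]

/-- The descending `q`-central sequence of a topological group, indexed from `1`:
`G⁽¹⁾ = G`, and `G⁽ⁱ⁺¹⁾` is the closed subgroup generated by all `h ^ q` and all
`[h, g] = h⁻¹ g⁻¹ h g` with `h ∈ G⁽ⁱ⁾`, `g ∈ G`. (The value at index `0` is a convention.) -/
def descendingCentral (q : ℕ) : ℕ → Subgroup G
  | 0 => ⊤
  | 1 => ⊤
  | i + 2 => (Subgroup.closure
      ({x | ∃ h ∈ descendingCentral q (i + 1), x = h ^ q} ∪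
        {x | ∃ h ∈ descendingCentral q (i + 1), ∃ g : G, x = h⁻¹ * g⁻¹ * h * g})).topologicalClosure

/-- The kernel of the projection of `G` onto its maximal pro-`p` quotient: the intersection of
all open normal subgroups whose quotient is a (finite) `p`-group. -/
def proPKernel (p : ℕ) : Subgroup G :=
  ⨅ (N : OpenNormalSubgroup G) (_ : IsPGroup p (G ⧸ N.toSubgroup)), N.toSubgroup

instance proPKernel_normal (p : ℕ) : (proPKernel G p).Normal :=
  Subgroup.normal_iInf_normal fun N => Subgroup.normal_iInf_normal fun _ => N.isNormal'

/-- The maximal pro-`p` quotient `G(p)` of a profinite group `G`, with its quotient topology. -/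
abbrev MaxProPQuotient (p : ℕ) : Type _ := G ⧸ proPKernel G p

end Groups

/-! ### Groups of exponent two and their central extensions -/

section ExponentTwo

/-! Squares in ℤ/4 and D₄ are central of order at most two, so `G⁽³⁾` lies in every `N`. Conversely,
each `s ∉ G⁽³⁾` has to survive in some quotient ℤ/4 or D₄. Such quotients come from relations `ψ ∪
ψ' = 0`: if `c` has coboundary `ψ(x)ψ'(y)`, then `(ψ, ψ', c)` is a homomorphism to the Heisenberg
group over 𝔽₂, which is D₄, and it is onto when `ψ`, `ψ'` are distinct and nonzero. When `ψ = ψ' ≠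
0`, the pair `(ψ, c)` maps onto ℤ/4.

Let `s ∈ G⁽²⁾`. A finite quotient and `exists_cochain_of_sq_mem_central` give `c` with `c(s) = 1`
whose coboundary is a sum of products of characters. Condition (i) splits this sum into pure tensors
with vanishing cup product. Cochains with equal coboundary differ by a character, and characters
vanish on `G⁽²⁾`; hence one pure tensor already has a cochain that is nonzero at `s`
(`exists_cup_cochain_of_mem_descendingCentral`).

Let `s ∉ G⁽²⁾`. Some character is nonzero at `s`. As `β(ψ) = ψ ∪ ψ`, condition (ii) says `ψ ∪ (ξ +
ψ) = 0`, so any `ψ ≠ ξ` with `ψ(s) ≠ 0` gives a quotient. Such a `ψ` is missing only if `ξ` is the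
sole nonzero character; then either a ℤ/4 quotient lifts `ξ`, or `G(2) ≅ ℤ/2`
(`nonempty_maxProPQuotient_equiv`), which is excluded. -/

theorem sq_mul_sq_mul_sq_eq_commutator {P : Type*} [Group P] (x y : P) :
    x⁻¹ * y⁻¹ * x * y = (x⁻¹) ^ 2 * (x * y⁻¹) ^ 2 * y ^ 2 := by
  simp only [pow_two]; group

theorem Subgroup.normal_of_forall_sq_mem {P : Type*} [Group P] {D : Subgroup P}
    (hD : ∀ x, x ^ 2 ∈ D) : D.Normal where
  conj_mem d hd g := by
    have e : g * d * g⁻¹ = (g * d) ^ 2 * d⁻¹ * (g⁻¹) ^ 2 := by simp only [pow_two]; group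
    rw [e]
    exact D.mul_mem (D.mul_mem (hD _) (D.inv_mem hd)) (hD _)

/-- A nontrivial element of a commutative group of exponent two is detected by a character. -/
theorem CommGroup.exists_character_eq_one {Q : Type*} [CommGroup Q] (h : ∀ x : Q, x ^ 2 = 1)
    {a : Q} (ha : a ≠ 1) :
    ∃ l : Q → ZMod 2, (∀ x y, l (x * y) = l x + l y) ∧ l a = 1 := by
  let : Module (ZMod 2) (Additive Q) := AddCommGroup.zmodModule fun x => h x.toMul
  have h0 : Additive.ofMul a ≠ 0 := ha
  rw [Ne, ← Module.forall_dual_apply_eq_zero_iff (ZMod 2), not_forall] at h0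
  obtain ⟨φ, hφ⟩ := h0
  refine ⟨fun x => φ (Additive.ofMul x), fun x y => by simp, ?_⟩
  exact Fin.eq_one_of_ne_zero _ hφ

/-- An element outside a subgroup that contains all squares is detected by a character which is
trivial on that subgroup. -/
theorem Subgroup.exists_character_of_notMem {P : Type*} [Group P] {D : Subgroup P}
    (hD : ∀ x, x ^ 2 ∈ D) {a : P} (ha : a ∉ D) :
    ∃ l : P → ZMod 2, (∀ x y, l (x * y) = l x + l y) ∧ (∀ d ∈ D, l d = 0) ∧ l a = 1 := by
  have := Subgroup.normal_of_forall_sq_mem hD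
  have hQ : ∀ x : P ⧸ D, x ^ 2 = 1 := by
    intro x
    induction x using QuotientGroup.induction_on with
    | H x => exact (QuotientGroup.eq_one_iff _).2 (hD x)
  let : CommGroup (P ⧸ D) := CommGroup.mk fun x y => by
    have e : x * y = y * x * (x⁻¹ * y⁻¹ * x * y) := by group
    rw [e, sq_mul_sq_mul_sq_eq_commutator, hQ, hQ, hQ]; simp
  obtain ⟨l, hl, hla⟩ := CommGroup.exists_character_eq_one (Q := P ⧸ D) hQ (a := (a : P ⧸ D))
    (fun h => ha ((QuotientGroup.eq_one_iff _).1 h))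
  have h1 : l 1 = 0 := by simpa using hl 1 1
  refine ⟨fun x => l x, fun x y => hl x y, fun d hd => ?_, hla⟩
  change l d = 0
  rw [(QuotientGroup.eq_one_iff d).2 hd, h1]

/-- A quadratic function on a finite commutative group of exponent two is a sum of products of
characters. -/
theorem CommGroup.exists_sum_characters_of_quadratic {Q : Type*} [CommGroup Q] [Finite Q]
    (h : ∀ x : Q, x ^ 2 = 1) (q : Q → ZMod 2)
    (hq : ∀ x y z, q (x * y * z) + q x + q y + q z = q (x * y) + q (y * z) + q (x * z)) :
    ∃ (n : ℕ) (u v : Fin n → Q → ZMod 2), (∀ i x y, u i (x * y) = u i x + u i y) ∧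
      (∀ i x y, v i (x * y) = v i x + v i y) ∧ ∀ x, q x = ∑ i, u i x * v i x := by
  let : Module (ZMod 2) (Additive Q) := AddCommGroup.zmodModule fun x => h x.toMul
  have h1 : q 1 = 0 := by
    have := hq 1 1 1
    simp only [mul_one] at this
    linear_combination this
  let f : Additive Q → ZMod 2 := fun x => q x.toMul
  have hadd : ∀ x x' y, QuadraticMap.polar f (x + x') y =
      QuadraticMap.polar f x y + QuadraticMap.polar f x' y := by
    intro x x' y
    have := hq x.toMul x'.toMul y.toMul
    simp only [QuadraticMap.polar, f, toMul_add]
    linear_combination this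
  have h0 : ∀ y, QuadraticMap.polar f 0 y = 0 := by
    intro y
    simp [QuadraticMap.polar, f, h1]
  let F : QuadraticForm (ZMod 2) (Additive Q) := QuadraticMap.ofPolar f
    (by
      intro a x
      fin_cases a
      · change f ((0 : ZMod 2) • x) = ((0 : ZMod 2) * 0) • f x
        simp [f, h1]
      · change f ((1 : ZMod 2) • x) = ((1 : ZMod 2) * 1) • f x
        simp)
    hadd
    (by
      intro a x y
      fin_cases a
      · change QuadraticMap.polar f ((0 : ZMod 2) • x) y = (0 : ZMod 2) • _
        rw [zero_smul, zero_smul, h0]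
      · change QuadraticMap.polar f ((1 : ZMod 2) • x) y = (1 : ZMod 2) • _
        rw [one_smul, one_smul])
  -- Even in characteristic two a quadratic form is the diagonal of a bilinear form, not necessarily
  -- symmetric. Expanding its first argument in a basis gives the products.
  obtain ⟨B, hB⟩ := LinearMap.BilinMap.toQuadraticMap_surjective F
  let b := Module.finBasis (ZMod 2) (Additive Q)
  refine ⟨_, fun i x => b.repr (Additive.ofMul x) i, fun i x => B (b i) (Additive.ofMul x),
    fun i x y => by simp, fun i x y => by simp, fun x => ?_⟩
  have e : q x = B (Additive.ofMul x) (Additive.ofMul x) :=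
    (DFunLike.congr_fun hB (Additive.ofMul x)).symm
  rw [e]
  calc B (Additive.ofMul x) (Additive.ofMul x)
      = B (∑ i, b.repr (Additive.ofMul x) i • b i) (Additive.ofMul x) := by rw [b.sum_repr]
    _ = _ := by simp only [map_sum, LinearMap.sum_apply, map_smul, LinearMap.smul_apply, smul_eq_mul]

/-- The set `P × ℤ/2`, to be endowed with the group law twisted by a biadditive pairing `b`. -/
structure TwistedProduct {P : Type*} (b : P → P → ZMod 2) where
  /-- The first component. -/
  fst : P
  /-- The second component. -/
  snd : ZMod 2

namespace TwistedProduct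

variable {P : Type*} [Group P] (b : P → P → ZMod 2)

/-- The central extension of `P` by `ℤ/2` given by the cocycle `b`. -/
abbrev groupOfBiadditive (hl : ∀ x y z, b (x * y) z = b x z + b y z)
    (hr : ∀ x y z, b x (y * z) = b x y + b x z) : Group (TwistedProduct b) :=
  letI : Mul (TwistedProduct b) := ⟨fun x y => ⟨x.1 * y.1, x.2 + y.2 + b x.1 y.1⟩⟩
  -- The correction is `b x x` because `b x⁻¹ x = - b x x`.
  letI : Inv (TwistedProduct b) := ⟨fun x => ⟨x.1⁻¹, - x.2 + b x.1 x.1⟩⟩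
  letI : One (TwistedProduct b) := ⟨⟨1, 0⟩⟩
  have h1 : ∀ y, b 1 y = 0 := fun y => by simpa using hl 1 1 y
  Group.ofLeftAxioms
    (by
      rintro ⟨x, s⟩ ⟨y, t⟩ ⟨z, r⟩
      change TwistedProduct.mk (x * y * z) (s + t + b x y + r + b (x * y) z) =
        TwistedProduct.mk (x * (y * z)) (s + (t + r + b y z) + b x (y * z))
      rw [mul_assoc, hl, hr]
      congr 1
      ring)
    (by
      rintro ⟨x, s⟩
      change TwistedProduct.mk (1 * x) (0 + s + b 1 x) = TwistedProduct.mk x s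
      simp [h1])
    (by
      rintro ⟨x, s⟩
      change TwistedProduct.mk (x⁻¹ * x) (- s + b x x + s + b x⁻¹ x) = TwistedProduct.mk 1 0
      have := hl x⁻¹ x x
      rw [inv_mul_cancel, h1] at this
      congr 1
      · simp
      · linear_combination - this)

end TwistedProduct

/-- If all squares lie in a central subgroup `A` of exponent two, a nontrivial element of `A` is
detected by a function whose coboundary is a sum of products of characters. -/
theorem exists_cochain_of_sq_mem_central {P : Type*} [Group P] [Finite P] (A : Subgroup P)
    (hc : ∀ a ∈ A, ∀ x, a * x = x * a) (h2 : ∀ a ∈ A, a ^ 2 = 1) (hA : ∀ x, x ^ 2 ∈ A)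
    {s : P} (hs : s ∈ A) (hs1 : s ≠ 1) :
    ∃ (n : ℕ) (u v : Fin n → P → ZMod 2) (c : P → ZMod 2),
      (∀ i x y, u i (x * y) = u i x + u i y) ∧ (∀ i x y, v i (x * y) = v i x + v i y) ∧
      (∀ x y, c x + c y - c (x * y) = ∑ i, u i x * v i y) ∧ c s = 1 := by
  obtain ⟨θ, hθ, -, hθs⟩ := Subgroup.exists_character_of_notMem (P := A) (D := ⊥)
    (fun x => by
      rw [Subgroup.mem_bot]
      exact Subtype.ext (h2 _ x.2)) (a := ⟨s, hs⟩) (by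
      rw [Subgroup.mem_bot]
      exact fun h => hs1 (congrArg Subtype.val h))
  have hθ1 : θ 1 = 0 := by simpa using hθ 1 1
  have := Subgroup.normal_of_forall_sq_mem hA
  have hQ : ∀ x : P ⧸ A, x ^ 2 = 1 := by
    intro x
    induction x using QuotientGroup.induction_on with
    | H x => exact (QuotientGroup.eq_one_iff _).2 (hA x)
  let : CommGroup (P ⧸ A) := CommGroup.mk fun x y => by
    have e : x * y = y * x * (x⁻¹ * y⁻¹ * x * y) := by group
    rw [e, sq_mul_sq_mul_sq_eq_commutator, hQ, hQ, hQ]; simp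
  -- Squaring, read through a character `θ` of `A` with `θ s = 1`, will be a quadratic function on
  -- `P ⧸ A`.
  let g : P → ZMod 2 := fun x => θ ⟨x ^ 2, hA x⟩
  have hgA : ∀ x, ∀ a ∈ A, g (x * a) = g x := by
    intro x a ha
    refine congrArg θ (Subtype.ext ?_)
    change (x * a) ^ 2 = x ^ 2
    rw [(show Commute x a from (hc a ha x).symm).mul_pow, h2 a ha, mul_one]
  have hinv : ∀ x : P, x ^ 2 * x = x⁻¹ := fun x => by
    rw [eq_inv_iff_mul_eq_one, mul_assoc, ← pow_two, ← pow_two, h2 _ (hA x)]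
  -- The polarization of squaring is a commutator; its multiplicativity in the first argument is
  -- `key` below.
  have hK : ∀ x y : P, (x * y) ^ 2 * x ^ 2 * y ^ 2 = x⁻¹ * y * x * y⁻¹ := fun x y => by
    rw [← hc _ (hA x), ← hinv x, ← hinv y, pow_two (x * y), (pow_mul_comm' y 2)]
    simp only [mul_assoc]
  have hgq : ∀ x y z, g (x * y * z) + g x + g y + g z = g (x * y) + g (y * z) + g (x * z) := by
    intro x y z
    have key : (⟨(x * y * z) ^ 2, hA _⟩ * ⟨(x * y) ^ 2, hA _⟩ * ⟨z ^ 2, hA z⟩ : A)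
        = ⟨(x * z) ^ 2, hA _⟩ * ⟨x ^ 2, hA x⟩ * ⟨z ^ 2, hA z⟩ *
          (⟨(y * z) ^ 2, hA _⟩ * ⟨y ^ 2, hA y⟩ * ⟨z ^ 2, hA z⟩) := by
      refine Subtype.ext ?_
      change (x * y * z) ^ 2 * (x * y) ^ 2 * z ^ 2 =
        (x * z) ^ 2 * x ^ 2 * z ^ 2 * ((y * z) ^ 2 * y ^ 2 * z ^ 2)
      have hxz : x⁻¹ * z * x * z⁻¹ ∈ A := by
        rw [← hK]
        exact A.mul_mem (A.mul_mem (hA _) (hA _)) (hA _)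
      have e := hc _ hxz y⁻¹
      rw [hK, hK, hK, mul_inv_rev]
      calc y⁻¹ * x⁻¹ * z * (x * y) * z⁻¹ = y⁻¹ * (x⁻¹ * z * x * z⁻¹) * (z * y * z⁻¹) := by group
        _ = _ := by rw [← e]; group
    have := congrArg θ key
    simp only [hθ] at this
    change g (x * y * z) + g (x * y) + g z = g (x * z) + g x + g z + (g (y * z) + g y + g z) at this
    linear_combination this +
      (g x + g y + g z - g (x * y)) * (CharTwo.two_eq_zero : (2 : ZMod 2) = 0)
  obtain ⟨n, u, v, hu, hv, huv⟩ := CommGroup.exists_sum_characters_of_quadratic hQ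
    (fun x => Quotient.liftOn' x g (fun x y hxy => by
      have := hgA x _ (QuotientGroup.leftRel_apply.1 hxy)
      rwa [mul_inv_cancel_left, eq_comm] at this))
    (by
      intro x y z
      induction x using QuotientGroup.induction_on
      induction y using QuotientGroup.induction_on
      induction z using QuotientGroup.induction_on
      exact hgq _ _ _)
  have hg : ∀ x : P, g x = ∑ i, u i x * v i x := fun x => huv x
  have hu1 : ∀ i, u i 1 = 0 := fun i => by simpa using hu i 1 1
  have huA : ∀ i, ∀ a ∈ A, u i (a : P) = 0 := fun i a ha => by
    rw [(QuotientGroup.eq_one_iff a).2 ha, hu1]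
  let b : P → P → ZMod 2 := fun x y => ∑ i, u i x * v i y
  have hbl : ∀ x y z, b (x * y) z = b x z + b y z := fun x y z => by
    simp only [b, QuotientGroup.mk_mul, hu, add_mul, Finset.sum_add_distrib]
  have hbr : ∀ x y z, b x (y * z) = b x y + b x z := fun x y z => by
    simp only [b, QuotientGroup.mk_mul, hv, mul_add, Finset.sum_add_distrib]
  have hbA : ∀ a ∈ A, ∀ y, b a y = 0 := fun a ha y =>
    Finset.sum_eq_zero fun i _ => by rw [huA i a ha, zero_mul]
  let := TwistedProduct.groupOfBiadditive b hbl hbr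
  have hmul : ∀ x y s t, (⟨x, s⟩ * ⟨y, t⟩ : TwistedProduct b) = ⟨x * y, s + t + b x y⟩ :=
    fun _ _ _ _ => rfl
  -- The graph of `θ`, a subgroup since `b` vanishes on `A × P`. It contains all squares, because
  -- `(x, t)² = (x², b x x)` and `b x x = g x = θ (x²)`, but not `(1, 1)`. A character `l` that is
  -- trivial on it with `l (1, 1) = 1` yields the cochain `x ↦ l (x, 0)`.
  let D : Subgroup (TwistedProduct b) :=
    { carrier := {p | ∃ a : A, p = ⟨a, θ a⟩}
      one_mem' := ⟨1, congrArg (TwistedProduct.mk 1) hθ1.symm⟩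
      mul_mem' := by
        rintro _ _ ⟨a, rfl⟩ ⟨a', rfl⟩
        refine ⟨a * a', ?_⟩
        rw [hmul, hθ, hbA a a.2, add_zero]
        rfl
      inv_mem' := by
        rintro _ ⟨a, rfl⟩
        refine ⟨a⁻¹, ?_⟩
        change TwistedProduct.mk _ (-θ a + b a a) = _
        have := hθ a⁻¹ a
        rw [inv_mul_cancel, hθ1] at this
        rw [hbA a a.2, add_zero, neg_eq_of_add_eq_zero_left this.symm]
        rfl }
  obtain ⟨l, hl, hlD, hl1⟩ := Subgroup.exists_character_of_notMem (D := D)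
    (by
      rintro ⟨x, s⟩
      refine ⟨⟨x ^ 2, hA x⟩, ?_⟩
      rw [pow_two, hmul, CharTwo.add_self_eq_zero, zero_add]
      exact congr (congrArg TwistedProduct.mk (pow_two x).symm) (hg x).symm) (a := ⟨1, 1⟩)
    (by
      rintro ⟨a, ha⟩
      have h1 : a = 1 := Subtype.ext (congrArg TwistedProduct.fst ha).symm
      have h2 : (1 : ZMod 2) = θ a := congrArg TwistedProduct.snd ha
      rw [h1, hθ1] at h2
      exact one_ne_zero h2)
  have hadd : ∀ x t, l ⟨x, t⟩ = l ⟨x, 0⟩ + t := by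
    intro x t
    have ht : t = 0 ∨ t = 1 := by revert t; decide
    obtain rfl | rfl := ht
    · simp
    · have hb1 : b x 1 = 0 := by simpa using hbr x 1 1
      have := hl ⟨x, 0⟩ ⟨1, 1⟩
      rwa [hmul, hl1, hb1, mul_one, zero_add, add_zero] at this
  refine ⟨n, fun i x => u i x, fun i x => v i x, fun x => l ⟨x, 0⟩, fun i x y => hu i x y,
    fun i x y => hv i x y, fun x y => ?_, ?_⟩
  · have := hl ⟨x, 0⟩ ⟨y, 0⟩
    rw [hmul, hadd, zero_add, zero_add] at this
    rw [← this, add_sub_cancel_left]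
  · have := hlD ⟨s, 1⟩ ⟨⟨s, hs⟩, by rw [hθs]⟩
    rw [hadd] at this
    change l ⟨s, 0⟩ = 1
    rw [eq_neg_of_add_eq_zero_left this]
    rfl

end ExponentTwo

/-! ### The descending 2-central sequence -/

section DescendingCentral

variable {G : Type*} [Group G] [TopologicalSpace G] [IsTopologicalGroup G]

theorem isClosed_descendingCentral (q i : ℕ) :
    IsClosed (descendingCentral G q (i + 2) : Set G) := by
  rw [descendingCentral]
  exact Subgroup.isClosed_topologicalClosure _

theorem pow_mem_descendingCentral {q i : ℕ} {h : G} (hh : h ∈ descendingCentral G q (i + 1)) :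
    h ^ q ∈ descendingCentral G q (i + 2) := by
  rw [descendingCentral]
  exact Subgroup.le_topologicalClosure _ (Subgroup.subset_closure (Or.inl ⟨h, hh, rfl⟩))

theorem commutator_mem_descendingCentral {q i : ℕ} {h : G}
    (hh : h ∈ descendingCentral G q (i + 1)) (g : G) :
    h⁻¹ * g⁻¹ * h * g ∈ descendingCentral G q (i + 2) := by
  rw [descendingCentral]
  exact Subgroup.le_topologicalClosure _ (Subgroup.subset_closure (Or.inr ⟨h, hh, g, rfl⟩))

theorem descendingCentral_le {q i : ℕ} {K : Subgroup G} (hK : IsClosed (K : Set G))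
    (h1 : ∀ h ∈ descendingCentral G q (i + 1), h ^ q ∈ K)
    (h2 : ∀ h ∈ descendingCentral G q (i + 1), ∀ g, h⁻¹ * g⁻¹ * h * g ∈ K) :
    descendingCentral G q (i + 2) ≤ K := by
  rw [descendingCentral]
  refine Subgroup.topologicalClosure_minimal _ ((Subgroup.closure_le K).2 ?_) hK
  rintro _ (⟨h, hh, rfl⟩ | ⟨h, hh, g, rfl⟩)
  · exact h1 h hh
  · exact h2 h hh g

theorem sq_mem_descendingCentral_two (x : G) : x ^ 2 ∈ descendingCentral G 2 2 :=
  pow_mem_descendingCentral (i := 0) (Subgroup.mem_top x)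

instance descendingCentral_two_two_normal : (descendingCentral G 2 2).Normal :=
  Subgroup.normal_of_forall_sq_mem sq_mem_descendingCentral_two

/-- Commutators are products of squares, so only squares need to be checked. -/
theorem descendingCentral_two_two_le {K : Subgroup G} (hK : IsClosed (K : Set G))
    (h : ∀ x, x ^ 2 ∈ K) : descendingCentral G 2 2 ≤ K :=
  descendingCentral_le (i := 0) hK (fun x _ => h x) fun x _ y => by
    rw [sq_mul_sq_mul_sq_eq_commutator]
    exact K.mul_mem (K.mul_mem (h _) (h _)) (h _)

theorem descendingCentral_two_three_le_two : descendingCentral G 2 3 ≤ descendingCentral G 2 2 :=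
  descendingCentral_le (i := 1) (isClosed_descendingCentral 2 0)
    (fun x _ => sq_mem_descendingCentral_two x) fun x _ y => by
      rw [sq_mul_sq_mul_sq_eq_commutator]
      exact mul_mem (mul_mem (sq_mem_descendingCentral_two _) (sq_mem_descendingCentral_two _))
        (sq_mem_descendingCentral_two _)

instance descendingCentral_two_three_normal : (descendingCentral G 2 3).Normal where
  conj_mem d hd g := by
    have e : g * d * g⁻¹ = d * (d⁻¹ * (g⁻¹)⁻¹ * d * g⁻¹) := by group
    rw [e]
    exact mul_mem hd
      (commutator_mem_descendingCentral (i := 1) (descendingCentral_two_three_le_two hd) _)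

/-- If the squares in `G ⧸ N` are central and of order at most two, then `G⁽³⁾ ≤ N`. -/
theorem descendingCentral_two_three_le_of_quotient {N : Subgroup G} [N.Normal]
    (hN : IsOpen (N : Set G)) (hc : ∀ x y : G ⧸ N, x ^ 2 * y = y * x ^ 2)
    (h4 : ∀ x : G ⧸ N, (x ^ 2) ^ 2 = 1) : descendingCentral G 2 3 ≤ N := by
  -- The preimage of the central elements of `G ⧸ N` killed by squaring; it is open because it
  -- contains `N`, hence closed.
  let K : Subgroup G :=
    { carrier := {x | (∀ y : G ⧸ N, (x : G ⧸ N) * y = y * x) ∧ (x : G ⧸ N) ^ 2 = 1}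
      one_mem' := by simp
      mul_mem' := by
        rintro a b ⟨ha, ha2⟩ ⟨hb, hb2⟩
        refine ⟨fun y => ?_, ?_⟩
        · rw [QuotientGroup.mk_mul, mul_assoc, hb, ← mul_assoc, ha, mul_assoc]
        · rw [QuotientGroup.mk_mul, (show Commute (a : G ⧸ N) b from ha b).mul_pow, ha2, hb2, one_mul]
      inv_mem' := by
        rintro a ⟨ha, ha2⟩
        refine ⟨fun y => ?_, ?_⟩
        · exact (show Commute (a : G ⧸ N) y from ha y).inv_left
        · rw [QuotientGroup.mk_inv, inv_pow, ha2, inv_one] }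
  have hNK : N ≤ K := fun x hx => by
    have : (x : G ⧸ N) = 1 := (QuotientGroup.eq_one_iff x).2 hx
    exact ⟨fun y => by rw [this, one_mul, mul_one], by rw [this, one_pow]⟩
  have hK : descendingCentral G 2 2 ≤ K :=
    descendingCentral_two_two_le (Subgroup.isClosed_of_isOpen _ (Subgroup.isOpen_mono hNK hN))
      fun x => ⟨hc x, h4 x⟩
  refine descendingCentral_le (i := 1) (Subgroup.isClosed_of_isOpen _ hN) (fun x hx => ?_)
    fun x hx y => ?_
  · exact (QuotientGroup.eq_one_iff _).1 (hK hx).2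
  · refine (QuotientGroup.eq_one_iff _).1 ?_
    have := (hK hx).1 (y : G ⧸ N)
    simp only [QuotientGroup.mk_mul, QuotientGroup.mk_inv]
    rw [mul_assoc, this]
    group

theorem descendingCentral_two_three_le_of_mulEquiv {Q : Type*} [Group Q] {N : Subgroup G}
    [N.Normal] (hN : IsOpen (N : Set G)) (e : G ⧸ N ≃* Q) (hc : ∀ x y : Q, x ^ 2 * y = y * x ^ 2)
    (h4 : ∀ x : Q, (x ^ 2) ^ 2 = 1) : descendingCentral G 2 3 ≤ N :=
  descendingCentral_two_three_le_of_quotient hN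
    (fun x y => e.injective (by simpa only [map_mul, map_pow] using hc (e x) (e y)))
    (fun x => e.injective (by simpa only [map_pow, map_one] using h4 (e x)))

/-- A point outside a closed normal subgroup of a profinite group can be separated from it by an
open normal subgroup. -/
theorem exists_openNormalSubgroup_of_notMem [CompactSpace G] [TotallyDisconnectedSpace G]
    {H : Subgroup G} [H.Normal] (hH : IsClosed (H : Set G)) {s : G} (hs : s ∉ H) :
    ∃ U : OpenNormalSubgroup G, H ≤ U.toSubgroup ∧ s ∉ U.toSubgroup := by
  obtain ⟨N, hN⟩ := ProfiniteGrp.exist_openNormalSubgroup_sub_open_nhds_of_one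
    (U := (fun g => s * g) ⁻¹' (H : Set G)ᶜ) (hH.isOpen_compl.preimage (by fun_prop))
    (by simpa using hs)
  have hn : N.toSubgroup.Normal := N.isNormal'
  refine ⟨{ toSubgroup := H ⊔ N.toSubgroup
            isOpen' := Subgroup.isOpen_mono (le_sup_right : N.toSubgroup ≤ _) N.isOpen'
            isNormal' := Subgroup.sup_normal _ _ }, le_sup_left, fun h => ?_⟩
  obtain ⟨a, ha, b, hb, hab⟩ := Subgroup.mem_sup_of_normal_right.1 h
  refine hN (inv_mem hb) ?_
  rw [← hab]
  simpa using ha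

end DescendingCentral

/-! ### Characters, cup products and cochains -/

namespace ProfiniteCohomology

theorem H1.map_mul {G : Type*} [Group G] [TopologicalSpace G] {q : ℕ} (ψ : H1 q G) (x y : G) :
    ψ.1 (x * y) = ψ.1 x + ψ.1 y := ψ.2 x y

variable {G : Type*} [Group G] [TopologicalSpace G] [IsTopologicalGroup G]

theorem H1.map_one {q : ℕ} (ψ : H1 q G) : ψ.1 1 = 0 := by
  simpa using H1.map_mul ψ 1 1

/-- The subgroup on which a character vanishes. -/
def H1.ker {q : ℕ} (ψ : H1 q G) : Subgroup G where
  carrier := {x | ψ.1 x = 0}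
  one_mem' := H1.map_one ψ
  mul_mem' := by
    intro a b (ha : ψ.1 a = 0) (hb : ψ.1 b = 0)
    change ψ.1 (a * b) = 0
    rw [H1.map_mul ψ, ha, hb, add_zero]
  inv_mem' := by
    intro a (ha : ψ.1 a = 0)
    have := H1.map_mul ψ a a⁻¹
    rw [mul_inv_cancel, H1.map_one ψ, ha, zero_add] at this
    exact this.symm

theorem H1.mem_ker {q : ℕ} {ψ : H1 q G} {x : G} : x ∈ H1.ker ψ ↔ ψ.1 x = 0 := Iff.rfl

theorem H1.isOpen_ker {q : ℕ} (ψ : H1 q G) : IsOpen (H1.ker ψ : Set G) :=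
  (isOpen_discrete {(0 : ZMod q)}).preimage ψ.1.continuous

theorem H1.eq_zero_of_mem_descendingCentral (ψ : H1 2 G) {s : G}
    (hs : s ∈ descendingCentral G 2 2) : ψ.1 s = 0 :=
  descendingCentral_two_two_le (K := H1.ker ψ) (Subgroup.isClosed_of_isOpen _ (H1.isOpen_ker ψ))
    (fun x => by rw [H1.mem_ker, pow_two, H1.map_mul ψ, CharTwo.add_self_eq_zero]) hs

/-- A character of an open quotient, as a continuous character. -/
def H1.ofQuotient {q : ℕ} (N : Subgroup G) [N.Normal] (hN : IsOpen (N : Set G))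
    (l : G ⧸ N → ZMod q) (hl : ∀ x y, l (x * y) = l x + l y) : H1 q G :=
  ⟨⟨fun x => l x,
    have := QuotientGroup.discreteTopology hN
    (continuous_of_discreteTopology (f := l)).comp continuous_quot_mk⟩, fun x y => hl x y⟩

theorem exists_cochain_of_cup_eq_zero {q : ℕ} {ψ ψ' : H1 q G} (h : cup q G ψ ψ' = 0) :
    ∃ c : C(G, ZMod q), ∀ x y, c x + c y - c (x * y) = ψ.1 x * ψ'.1 y := by
  obtain ⟨c, hc⟩ := (QuotientAddGroup.eq_zero_iff _).1 h
  exact ⟨c, fun x y => DFunLike.congr_fun hc (x, y)⟩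

/-- For residues mod 2 the carry is the product, so the cocycles agree on the nose. -/
theorem bockstein_eq_cup_self (ψ : H1 2 G) : bockstein ψ = cup 2 G ψ ψ := by
  refine congrArg H2.mk (Subtype.ext (ContinuousMap.ext fun x => ?_))
  have : ∀ a b : ZMod 2, (carry a b : ZMod 2) = a * b := by decide
  exact this _ _

variable (G) in
/-- The map sending `ψ ⊗ ψ'` to the cochain `(x, y) ↦ ψ x * ψ' y`. -/
noncomputable def tensorCochain (q : ℕ) : (H1 q G) ⊗[ℤ] (H1 q G) →+ C(G × G, ZMod q) :=
  TensorProduct.liftAddHom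
    (AddMonoidHom.mk' (fun ψ => AddMonoidHom.mk' (fun ψ' => (cupCocycle ψ ψ').1) (by
      intro a b
      ext x
      exact mul_add _ _ _)) (by
      intro a b
      ext ψ' x
      exact add_mul _ _ _)) (by
      intro n ψ ψ'
      simp only [map_zsmul]
      rfl)

theorem exists_mk_eq_cupTensor {q : ℕ} (t : (H1 q G) ⊗[ℤ] (H1 q G)) :
    ∃ z : Z2 q G, H2.mk z = cupTensor q G t ∧ z.1 = tensorCochain G q t := by
  induction t using TensorProduct.induction_on with
  | zero => exact ⟨0, by simp, by simp⟩
  | tmul ψ ψ' => exact ⟨cupCocycle ψ ψ', rfl, rfl⟩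
  | add a b ha hb =>
    obtain ⟨z, hz, hz'⟩ := ha
    obtain ⟨w, hw, hw'⟩ := hb
    exact ⟨z + w, by rw [map_add, map_add, hz, hw], by
      rw [map_add, ← hz', ← hw']
      rfl⟩

/-- Makes the kernel explicit in cochains, whose values at a point can then be tracked. -/
theorem mem_ker_cupTensor_iff {q : ℕ} {t : (H1 q G) ⊗[ℤ] (H1 q G)} :
    t ∈ (cupTensor q G).ker ↔ ∃ c : C(G, ZMod q), d1 q G c = tensorCochain G q t := by
  obtain ⟨z, hz, hz'⟩ := exists_mk_eq_cupTensor t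
  rw [AddMonoidHom.mem_ker, ← hz, ← hz']
  exact QuotientAddGroup.eq_zero_iff z

theorem exists_cup_cochain_of_mem_descendingCentral [CompactSpace G] [TotallyDisconnectedSpace G]
    (hG : AddSubgroup.closure {x : (H1 2 G) ⊗[ℤ] (H1 2 G) |
      x ∈ (cupTensor 2 G).ker ∧ ∃ ψ ψ' : H1 2 G, x = ψ ⊗ₜ[ℤ] ψ'} = (cupTensor 2 G).ker)
    {s : G} (hs : s ∈ descendingCentral G 2 2) (hs' : s ∉ descendingCentral G 2 3) :
    ∃ (ψ ψ' : H1 2 G) (c : C(G, ZMod 2)),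
      (∀ x y, c x + c y - c (x * y) = ψ.1 x * ψ'.1 y) ∧ c s ≠ 0 := by
  obtain ⟨U, hU, hsU⟩ := exists_openNormalSubgroup_of_notMem
    (H := descendingCentral G 2 3) (isClosed_descendingCentral 2 1) hs'
  have hn : U.toSubgroup.Normal := U.isNormal'
  have hfin : Finite (G ⧸ U.toSubgroup) := Subgroup.quotient_finite_of_isOpen _ U.isOpen'
  have hdis := QuotientGroup.discreteTopology (N := U.toSubgroup) U.isOpen'
  obtain ⟨n, u, v, c, hu, hv, hc, hcs⟩ := exists_cochain_of_sq_mem_central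
    ((descendingCentral G 2 2).map (QuotientGroup.mk' U.toSubgroup))
    (by
      rintro _ ⟨a, ha, rfl⟩ x
      induction x using QuotientGroup.induction_on with
      | H x =>
        have := (QuotientGroup.eq_one_iff _).2
          (hU (commutator_mem_descendingCentral (i := 1) ha x))
        simp only [QuotientGroup.mk_mul, QuotientGroup.mk_inv] at this
        change (a : G ⧸ U.toSubgroup) * x = x * a
        calc (a : G ⧸ U.toSubgroup) * x
            = x * a * ((a : G ⧸ U.toSubgroup)⁻¹ * (x : G ⧸ U.toSubgroup)⁻¹ * a * x) := by
              group
          _ = _ := by rw [this, mul_one])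
    (by
      rintro _ ⟨a, ha, rfl⟩
      exact (QuotientGroup.eq_one_iff _).2 (hU (pow_mem_descendingCentral (i := 1) ha)))
    (by
      intro x
      induction x using QuotientGroup.induction_on with
      | H x => exact ⟨x ^ 2, sq_mem_descendingCentral_two x, rfl⟩)
    (s := (s : G ⧸ U.toSubgroup)) ⟨s, hs, rfl⟩ (fun h => hsU ((QuotientGroup.eq_one_iff s).1 h))
  let c' : C(G, ZMod 2) :=
    ⟨fun x => c x, (continuous_of_discreteTopology (f := c)).comp continuous_quot_mk⟩
  let t : (H1 2 G) ⊗[ℤ] (H1 2 G) := ∑ i,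
    H1.ofQuotient _ U.isOpen' (u i) (hu i) ⊗ₜ H1.ofQuotient _ U.isOpen' (v i) (hv i)
  have hct : d1 2 G c' = tensorCochain G 2 t := by
    ext ⟨x, y⟩
    rw [map_sum, ContinuousMap.sum_apply]
    exact hc x y
  by_contra! hcon
  -- Bounding a tensor by a cochain that vanishes at `s` is an additive condition, so it passes from
  -- the pure tensors to the whole kernel.
  have key : ∀ t ∈ (cupTensor 2 G).ker, ∃ c : C(G, ZMod 2),
      d1 2 G c = tensorCochain G 2 t ∧ c s = 0 := by
    intro t ht
    rw [← hG] at ht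
    induction ht using AddSubgroup.closure_induction with
    | mem x hx =>
      obtain ⟨hx, ψ, ψ', rfl⟩ := hx
      obtain ⟨c, hc⟩ := mem_ker_cupTensor_iff.1 hx
      exact ⟨c, hc, hcon ψ ψ' c fun x y => DFunLike.congr_fun hc (x, y)⟩
    | zero => exact ⟨0, by simp, rfl⟩
    | add x y _ _ hx hy =>
      obtain ⟨c, hc, hcs⟩ := hx
      obtain ⟨d, hd, hds⟩ := hy
      exact ⟨c + d, by rw [map_add, map_add, hc, hd], by
        rw [ContinuousMap.add_apply, hcs, hds, add_zero]⟩
    | neg x _ hx =>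
      obtain ⟨c, hc, hcs⟩ := hx
      exact ⟨-c, by rw [map_neg, map_neg, hc], by rw [ContinuousMap.neg_apply, hcs, neg_zero]⟩
  obtain ⟨d, hd, hds⟩ := key t (mem_ker_cupTensor_iff.2 ⟨c', hct⟩)
  have hψ : ∀ x y, (c' - d) (x * y) = (c' - d) x + (c' - d) y := by
    intro x y
    have h0 : d1 2 G (c' - d) = 0 := by rw [map_sub, hct, hd, sub_self]
    have : (c' - d) x + (c' - d) y - (c' - d) (x * y) = 0 := DFunLike.congr_fun h0 (x, y)
    exact (sub_eq_zero.1 this).symm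
  have h0 : (c' - d) s = 0 := H1.eq_zero_of_mem_descendingCentral ⟨c' - d, hψ⟩ hs
  rw [ContinuousMap.sub_apply, hds, sub_zero] at h0
  exact one_ne_zero (hcs.symm.trans h0)

end ProfiniteCohomology

/-! ### Quotients isomorphic to ℤ/4 and D₄ -/

namespace ProfiniteCohomology

variable {G : Type*} [Group G] [TopologicalSpace G] [IsTopologicalGroup G]

/-- The kernel of a homomorphism with open kernel, as an open normal subgroup. -/
def openNormalKer {K : Type*} [Group K] (φ : G →* K) (hφ : IsOpen (φ.ker : Set G)) :
    OpenNormalSubgroup G :=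
  { toSubgroup := φ.ker
    isOpen' := hφ
    isNormal' := inferInstance }

/-- The identification of `ℤ/2 × ℤ/2 × ℤ/2`, with multiplication
`(a, b, s) (a', b', s') = (a + a', b + b', s + s' + a b')`, with the dihedral group. -/
def heisenbergToDihedral (x : ZMod 2 × ZMod 2 × ZMod 2) : DihedralGroup 4 :=
  -- `(a, b, s) = (a, 0, 0)(0, b, 0)(0, 0, s + ab)`: two reflections whose product has order four,
  -- and a central factor.
  .sr 0 ^ x.1.val * .sr 1 ^ x.2.1.val * .r 2 ^ (x.2.2 + x.1 * x.2.1).val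

theorem heisenbergToDihedral_mul : ∀ a b s a' b' s' : ZMod 2,
    heisenbergToDihedral (a + a', b + b', s + s' + a * b') =
      heisenbergToDihedral (a, b, s) * heisenbergToDihedral (a', b', s') := by
  decide

theorem heisenbergToDihedral_eq_one : ∀ a b s : ZMod 2,
    heisenbergToDihedral (a, b, s) = 1 → a = 0 ∧ b = 0 ∧ s = 0 := by
  decide

theorem exists_eq_heisenbergToDihedral_mul : ∀ (s t : ZMod 2) (d : DihedralGroup 4),
    ∃ i j k : Fin 2, heisenbergToDihedral (1, 0, s) ^ i.val *
      heisenbergToDihedral (0, 1, t) ^ j.val *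
      (heisenbergToDihedral (1, 0, s) * heisenbergToDihedral (0, 1, t)) ^ (2 * k.val) = d := by
  decide

/-- Take `x` with `ψ'(x) ≠ 0` and `y` where the characters differ; one of `x`, `y`, `xy` works. -/
theorem exists_eq_zero_eq_one {G : Type*} [Group G] [TopologicalSpace G] {ψ ψ' : H1 2 G}
    (h' : ψ' ≠ 0) (hne : ψ ≠ ψ') : ∃ x, ψ.1 x = 0 ∧ ψ'.1 x = 1 := by
  obtain ⟨x, hx⟩ : ∃ x, ψ'.1 x ≠ 0 := by
    by_contra! h
    exact h' (Subtype.ext (ContinuousMap.ext h))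
  obtain ⟨y, hy⟩ : ∃ y, ψ.1 y ≠ ψ'.1 y := by
    by_contra! h
    exact hne (Subtype.ext (ContinuousMap.ext h))
  have hxy := H1.map_mul ψ x y
  have hxy' := H1.map_mul ψ' x y
  have key : ∀ a a' b b' : ZMod 2, a' ≠ 0 → b ≠ b' →
      (a = 0 ∧ a' = 1) ∨ (b = 0 ∧ b' = 1) ∨ (a + b = 0 ∧ a' + b' = 1) := by decide
  obtain h | h | h := key _ (ψ'.1 x) _ (ψ'.1 y) hx hy
  · exact ⟨x, h⟩
  · exact ⟨y, h⟩
  · exact ⟨x * y, by rwa [hxy, hxy']⟩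

/-- The dihedral quotient attached to a vanishing cup product of independent characters. -/
theorem exists_dihedral_quotient {ψ ψ' : H1 2 G} (h : ψ ≠ 0) (h' : ψ' ≠ 0) (hne : ψ ≠ ψ')
    (c : C(G, ZMod 2)) (hc : ∀ x y, c x + c y - c (x * y) = ψ.1 x * ψ'.1 y) :
    ∃ N : OpenNormalSubgroup G, Nonempty (G ⧸ N.toSubgroup ≃* DihedralGroup 4) ∧
      ∀ s ∈ N.toSubgroup, ψ.1 s = 0 ∧ ψ'.1 s = 0 ∧ c s = 0 := by
  let φ : G →* DihedralGroup 4 :=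
    MonoidHom.mk' (fun x => heisenbergToDihedral (ψ.1 x, ψ'.1 x, c x)) (by
      intro x y
      have e : c (x * y) = c x + c y + ψ.1 x * ψ'.1 y := by
        rw [← hc, CharTwo.sub_eq_add, ← add_assoc, CharTwo.add_self_eq_zero, zero_add]
      rw [← heisenbergToDihedral_mul, ← e, H1.map_mul, H1.map_mul])
  have hφ : IsOpen (φ.ker : Set G) :=
    (isOpen_discrete {x | heisenbergToDihedral x = 1}).preimage
      (ψ.1.continuous.prodMk (ψ'.1.continuous.prodMk c.continuous))
  obtain ⟨x, hx', hx⟩ := exists_eq_zero_eq_one h hne.symm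
  obtain ⟨y, hy, hy'⟩ := exists_eq_zero_eq_one h' hne
  have hφx : φ x = heisenbergToDihedral (1, 0, c x) := by
    rw [← hx, ← hx']; rfl
  have hφy : φ y = heisenbergToDihedral (0, 1, c y) := by
    rw [← hy, ← hy']; rfl
  have hsurj : Function.Surjective φ := by
    intro d
    obtain ⟨i, j, k, hd⟩ := exists_eq_heisenbergToDihedral_mul (c x) (c y) d
    refine ⟨x ^ i.val * y ^ j.val * (x * y) ^ (2 * k.val), ?_⟩
    rw [← hd, ← hφx, ← hφy]
    simp only [map_mul, map_pow]
  exact ⟨openNormalKer φ hφ, ⟨QuotientGroup.quotientKerEquivOfSurjective φ hsurj⟩,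
    fun s hs => heisenbergToDihedral_eq_one _ _ _ hs⟩

/-- The cyclic quotient of order four attached to a character with vanishing cup square. -/
theorem exists_cyclic_quotient {ψ : H1 2 G} (h : ψ ≠ 0)
    (c : C(G, ZMod 2)) (hc : ∀ x y, c x + c y - c (x * y) = ψ.1 x * ψ.1 y) :
    ∃ N : OpenNormalSubgroup G, Nonempty (G ⧸ N.toSubgroup ≃* Multiplicative (ZMod 4)) ∧
      ∀ s ∈ N.toSubgroup, ψ.1 s = 0 ∧ c s = 0 := by
  -- Binary digits: the carry of the low digits is `a * a'`, the coboundary of `c`.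
  let f : ZMod 2 × ZMod 2 → ZMod 4 := fun x => (x.1.val + 2 * x.2.val : ℕ)
  have hf : ∀ a s a' s' : ZMod 2, f (a + a', s + s' + a * a') = f (a, s) + f (a', s') := by
    decide
  have hf0 : ∀ a s : ZMod 2, f (a, s) = 0 → a = 0 ∧ s = 0 := by decide
  have hf1 : ∀ (s : ZMod 2) (d : ZMod 4), ∃ i : Fin 4, i.val • f (1, s) = d := by decide
  let φ : G →* Multiplicative (ZMod 4) :=
    MonoidHom.mk' (fun x => Multiplicative.ofAdd (f (ψ.1 x, c x))) (by
      intro x y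
      have e : c (x * y) = c x + c y + ψ.1 x * ψ.1 y := by
        rw [← hc, CharTwo.sub_eq_add, ← add_assoc, CharTwo.add_self_eq_zero, zero_add]
      rw [← ofAdd_add, ← hf, ← e, H1.map_mul])
  have hφ : IsOpen (φ.ker : Set G) :=
    (isOpen_discrete {x | f x = 0}).preimage (ψ.1.continuous.prodMk c.continuous)
  obtain ⟨x, -, hx⟩ := exists_eq_zero_eq_one h h.symm
  have hsurj : Function.Surjective φ := by
    intro d
    obtain ⟨i, hd⟩ := hf1 (c x) d.toAdd
    refine ⟨x ^ i.val, ?_⟩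
    rw [map_pow]
    change Multiplicative.ofAdd (i.val • f (ψ.1 x, c x)) = d
    rw [hx, hd]
    rfl
  exact ⟨openNormalKer φ hφ, ⟨QuotientGroup.quotientKerEquivOfSurjective φ hsurj⟩,
    fun s hs => hf0 _ _ hs⟩

/-- If `ξ` is the only nontrivial character and there is no quotient of order four, every open
normal subgroup whose quotient is a `2`-group contains the kernel of `ξ`. -/
theorem ker_le_of_isPGroup [CompactSpace G] {ξ : H1 2 G} (hξ : ξ ≠ 0)
    (huniq : ∀ ψ : H1 2 G, ψ ≠ 0 → ψ = ξ)
    (hno : ∀ N : OpenNormalSubgroup G, IsEmpty (G ⧸ N.toSubgroup ≃* Multiplicative (ZMod 4)))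
    (N : OpenNormalSubgroup G) (hN : IsPGroup 2 (G ⧸ N.toSubgroup)) :
    H1.ker ξ ≤ N.toSubgroup := by
  have hfin : Finite (G ⧸ N.toSubgroup) := Subgroup.quotient_finite_of_isOpen _ N.isOpen'
  obtain ⟨g, -, hg⟩ := exists_eq_zero_eq_one hξ hξ.symm
  have hchar : ∀ l : G ⧸ N.toSubgroup → ZMod 2, (∀ x y, l (x * y) = l x + l y) →
      l (g : G ⧸ N.toSubgroup) = 0 → ∀ x, l x = 0 := by
    intro l hl hlg x
    by_contra hx
    have := huniq (H1.ofQuotient _ N.isOpen' l hl) (by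
      intro h0
      induction x using QuotientGroup.induction_on with
      | H x => exact hx (DFunLike.congr_fun (congrArg Subtype.val h0) x))
    have hl1 : l (g : G ⧸ N.toSubgroup) = ξ.1 g :=
      DFunLike.congr_fun (congrArg Subtype.val this) g
    rw [hlg, hg] at hl1
    exact zero_ne_one hl1
  obtain ⟨n, hn⟩ := IsPGroup.iff_card.1 hN
  obtain ⟨k, hk⟩ := IsPGroup.iff_card.1 (hN.to_subgroup (Subgroup.zpowers (g : G ⧸ N.toSubgroup)))
  have hkn : k ≤ n := by
    have := Subgroup.card_subgroup_dvd_card (Subgroup.zpowers (g : G ⧸ N.toSubgroup))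
    rw [hn, hk] at this
    exact (Nat.pow_dvd_pow_iff_le_right (by norm_num)).1 this
  -- If `g` did not generate the quotient, it would lie in a subgroup of index two, whose character
  -- is nonzero but vanishes at `g`, against `hchar`.
  have hgen : k = n := by
    by_contra hne
    obtain ⟨m, rfl⟩ : ∃ m, n = m + 1 := ⟨n - 1, by omega⟩
    obtain ⟨K, hK, hgK⟩ := Sylow.exists_subgroup_card_pow_prime_le 2 (m := m)
      (by rw [hn]; exact pow_dvd_pow 2 (by omega)) _ hk (by omega)
    have hidx : K.index = 2 := by
      have := K.card_mul_index
      rw [hK, hn, pow_succ] at this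
      exact Nat.eq_of_mul_eq_mul_left (by positivity) this
    obtain ⟨a, ha⟩ : ∃ a, a ∉ K := by
      by_contra! h
      rw [(Subgroup.eq_top_iff' K).2 h, Subgroup.index_top] at hidx
      omega
    obtain ⟨l, hl, hlK, hla⟩ := Subgroup.exists_character_of_notMem (D := K)
      (fun x => Subgroup.sq_mem_of_index_two hidx x) ha
    have := hchar l hl (hlK _ (hgK (Subgroup.mem_zpowers _))) a
    exact zero_ne_one (this.symm.trans hla)
  subst hgen
  have htop : Subgroup.zpowers (g : G ⧸ N.toSubgroup) = ⊤ :=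
    Subgroup.eq_top_of_card_eq _ (by rw [hk, hn])
  have hcyc : IsCyclic (G ⧸ N.toSubgroup) :=
    ⟨g, fun x => Subgroup.mem_zpowers_iff.1 (htop ▸ Subgroup.mem_top x)⟩
  -- A cyclic 2-group of order at least four maps onto ℤ/4.
  have hcard : k < 2 := by
    by_contra! hk2
    have hdvd : 4 ∣ Nat.card (G ⧸ N.toSubgroup) := by
      rw [hn]
      exact pow_dvd_pow 2 hk2
    let φ : G →* Multiplicative (ZMod 4) :=
      ((AddMonoidHom.toMultiplicative (ZMod.castHom hdvd (ZMod 4)).toAddMonoidHom).comp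
        (zmodCyclicMulEquiv hcyc).symm.toMonoidHom).comp (QuotientGroup.mk' N.toSubgroup)
    have hle : N.toSubgroup ≤ φ.ker := fun x hx => by
      have : QuotientGroup.mk' N.toSubgroup x = 1 := (QuotientGroup.eq_one_iff x).2 hx
      rw [MonoidHom.mem_ker, MonoidHom.comp_apply, this, _root_.map_one]
    have hsurj : Function.Surjective φ :=
      ((ZMod.castHom_surjective hdvd).comp (zmodCyclicMulEquiv hcyc).symm.surjective).comp
        (QuotientGroup.mk'_surjective _)
    exact (hno (openNormalKer φ (Subgroup.isOpen_mono hle N.isOpen'))).false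
      (QuotientGroup.quotientKerEquivOfSurjective φ hsurj)
  have hsq : ∀ x : G ⧸ N.toSubgroup, x ^ 2 = 1 := by
    intro x
    rw [← orderOf_dvd_iff_pow_eq_one]
    refine (orderOf_dvd_natCard x).trans ?_
    rw [hn]
    exact pow_dvd_pow 2 (by omega : k ≤ 1)
  intro x hx
  by_contra hxN
  obtain ⟨l, hl, -, hlx⟩ := Subgroup.exists_character_of_notMem (D := ⊥)
    (fun x : G ⧸ N.toSubgroup => by rw [Subgroup.mem_bot]; exact hsq x) (a := (x : G ⧸ N.toSubgroup))
    (fun h => hxN ((QuotientGroup.eq_one_iff x).1 (Subgroup.mem_bot.1 h)))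
  have h0 : H1.ofQuotient _ N.isOpen' l hl ≠ 0 := fun h0 =>
    one_ne_zero (hlx.symm.trans (DFunLike.congr_fun (congrArg Subtype.val h0) x))
  have := DFunLike.congr_fun (congrArg Subtype.val (huniq _ h0)) x
  exact one_ne_zero (hlx.symm.trans (this.trans hx))

/-- If `ξ` is the only nontrivial character and there is no quotient of order four, then the maximal
pro-`2` quotient has order two. -/
theorem nonempty_maxProPQuotient_equiv [CompactSpace G] {ξ : H1 2 G} (hξ : ξ ≠ 0)
    (huniq : ∀ ψ : H1 2 G, ψ ≠ 0 → ψ = ξ)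
    (hno : ∀ N : OpenNormalSubgroup G, IsEmpty (G ⧸ N.toSubgroup ≃* Multiplicative (ZMod 4))) :
    Nonempty (MaxProPQuotient G 2 ≃ₜ* Multiplicative (ZMod 2)) := by
  let φ : G →* Multiplicative (ZMod 2) :=
    MonoidHom.mk' (fun x => Multiplicative.ofAdd (ξ.1 x)) fun x y => H1.map_mul ξ x y
  have hφ : IsOpen (φ.ker : Set G) := H1.isOpen_ker ξ
  obtain ⟨g, -, hg⟩ := exists_eq_zero_eq_one hξ hξ.symm
  have hsurj : Function.Surjective φ := by
    intro d
    have : ∀ d : ZMod 2, d = 0 ∨ d = 1 := by decide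
    obtain h | h := this d.toAdd
    · exact ⟨1, (_root_.map_one φ).trans h.symm⟩
    · exact ⟨g, (show φ g = d from hg.trans h.symm)⟩
  have hker : proPKernel G 2 = φ.ker := by
    refine le_antisymm ?_ (le_iInf fun N => le_iInf fun hN => ?_)
    · refine iInf₂_le (openNormalKer φ hφ) ?_
      refine IsPGroup.of_equiv ?_ (QuotientGroup.quotientKerEquivOfSurjective φ hsurj).symm
      exact IsPGroup.of_card (n := 1) (by simp [Nat.card_eq_fintype_card, ZMod.card])
    · exact ker_le_of_isPGroup hξ huniq hno N hN
  have hopen : IsOpen (proPKernel G 2 : Set G) := by rw [hker]; exact hφ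
  have hdis := QuotientGroup.discreteTopology hopen
  exact ⟨{ (QuotientGroup.quotientMulEquivOfEq hker).trans
            (QuotientGroup.quotientKerEquivOfSurjective φ hsurj) with
          continuous_toFun := continuous_of_discreteTopology
          continuous_invFun := continuous_of_discreteTopology }⟩

theorem exists_quotient_of_notMem_descendingCentral_two [CompactSpace G]
    [TotallyDisconnectedSpace G]
    (hG : ∃ ξ : H1 2 G, ∀ ψ : H1 2 G, cup 2 G ψ ξ + bockstein ψ = 0)
    (hG2 : ¬ Nonempty (MaxProPQuotient G 2 ≃ₜ* Multiplicative (ZMod 2)))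
    {s : G} (hs : s ∉ descendingCentral G 2 2) :
    ∃ N : OpenNormalSubgroup G, (Nonempty (G ⧸ N.toSubgroup ≃* Multiplicative (ZMod 4)) ∨
      Nonempty (G ⧸ N.toSubgroup ≃* DihedralGroup 4)) ∧ s ∉ N.toSubgroup := by
  obtain ⟨ξ, hξ⟩ := hG
  have hcup : ∀ ψ : H1 2 G, cup 2 G ψ (ξ + ψ) = 0 := fun ψ => by
    rw [map_add, ← bockstein_eq_cup_self, hξ]
  have hdouble : ∀ ψ : H1 2 G, ψ + ψ = 0 := fun ψ =>
    Subtype.ext (ContinuousMap.ext fun x => CharTwo.add_self_eq_zero _)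
  have main : ∀ ψ : H1 2 G, ψ.1 s ≠ 0 → ψ ≠ ξ →
      ∃ N : OpenNormalSubgroup G, (Nonempty (G ⧸ N.toSubgroup ≃* Multiplicative (ZMod 4)) ∨
        Nonempty (G ⧸ N.toSubgroup ≃* DihedralGroup 4)) ∧ s ∉ N.toSubgroup := by
    intro ψ hψs hψξ
    have hψ : ψ ≠ 0 := by
      rintro rfl
      exact hψs rfl
    obtain ⟨c, hc⟩ := exists_cochain_of_cup_eq_zero (hcup ψ)
    -- The relation `ψ ∪ (ξ + ψ) = 0` has equal factors exactly when `ξ = 0`.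
    by_cases h0 : ξ = 0
    · subst h0
      rw [zero_add] at hc
      obtain ⟨N, hN, hN'⟩ := exists_cyclic_quotient hψ c hc
      exact ⟨N, Or.inl hN, fun h => hψs (hN' s h).1⟩
    · obtain ⟨N, hN, hN'⟩ := exists_dihedral_quotient hψ
        (fun h => hψξ ((add_right_cancel (h.trans (hdouble ψ).symm)).symm))
        (fun h => h0 (by simpa using h)) c hc
      exact ⟨N, Or.inr hN, fun h => hψs (hN' s h).1⟩
  obtain ⟨U, hU, hsU⟩ := exists_openNormalSubgroup_of_notMem (H := descendingCentral G 2 2)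
    (isClosed_descendingCentral 2 0) hs
  obtain ⟨l, hl, -, hls⟩ := Subgroup.exists_character_of_notMem (D := ⊥)
    (P := G ⧸ U.toSubgroup) (a := (s : G ⧸ U.toSubgroup))
    (fun x => by
      induction x using QuotientGroup.induction_on with
      | H x => exact (QuotientGroup.eq_one_iff _).2 (hU (sq_mem_descendingCentral_two x)))
    (fun h => hsU ((QuotientGroup.eq_one_iff s).1 (Subgroup.mem_bot.1 h)))
  let χ : H1 2 G := H1.ofQuotient _ U.isOpen' l hl
  have hχs : χ.1 s = 1 := hls
  by_cases hχ : χ = ξ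
  · by_cases hex : ∃ ψ : H1 2 G, ψ ≠ 0 ∧ ψ ≠ χ
    · obtain ⟨ψ, hψ0, hψ⟩ := hex
      by_cases hψs : ψ.1 s = 0
      -- Adding `ψ` moves `χ` away from `ξ` without changing its value at `s`.
      · refine main (χ + ψ) ?_ ?_
        · change χ.1 s + ψ.1 s ≠ 0
          rw [hχs, hψs, add_zero]
          exact one_ne_zero
        · rw [← hχ]
          simpa using hψ0
      · exact main ψ hψs (hχ ▸ hψ)
    · push Not at hex
      have hχ0 : χ ≠ 0 := by
        intro h
        rw [h] at hχs
        exact zero_ne_one hχs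
      -- The mod 2 reduction of a ℤ/4 quotient is a nonzero character, hence `χ`, so `s` survives
      -- there. Under `hcon` no such quotient exists.
      by_contra! hcon
      refine hG2 (nonempty_maxProPQuotient_equiv hχ0 hex fun N => ⟨fun e => ?_⟩)
      have hsN := hcon N (Or.inl ⟨e⟩)
      let ω : H1 2 G := H1.ofQuotient _ N.isOpen'
        (fun x => ZMod.castHom (by norm_num : 2 ∣ 4) (ZMod 2) (e x).toAdd)
        (fun x y => by rw [_root_.map_mul, toAdd_mul, map_add])
      have hω : ω = χ := by
        refine hex ω fun h0 => ?_
        obtain ⟨x, hx⟩ := QuotientGroup.mk_surjective (e.symm (Multiplicative.ofAdd 1))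
        have := DFunLike.congr_fun (congrArg Subtype.val h0) x
        change ZMod.castHom (by norm_num : 2 ∣ 4) (ZMod 2) (e (x : G ⧸ N.toSubgroup)).toAdd = 0 at this
        rw [hx, e.apply_symm_apply, toAdd_ofAdd, _root_.map_one] at this
        exact one_ne_zero this
      have hωs : ω.1 s = 0 := by
        change ZMod.castHom (by norm_num : 2 ∣ 4) (ZMod 2) (e (s : G ⧸ N.toSubgroup)).toAdd = 0
        rw [(QuotientGroup.eq_one_iff s).2 hsN, _root_.map_one, toAdd_one, map_zero]
      rw [hω, hχs] at hωs
      exact one_ne_zero hωs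
  · exact main χ (by rw [hχs]; exact one_ne_zero) hχ

theorem exists_quotient_of_notMem_descendingCentral_three [CompactSpace G]
    [TotallyDisconnectedSpace G] (hG : IsGaloisRelationType 2 G)
    (hG2 : ¬ Nonempty (MaxProPQuotient G 2 ≃ₜ* Multiplicative (ZMod 2)))
    {s : G} (hs : s ∉ descendingCentral G 2 3) :
    ∃ N : OpenNormalSubgroup G, (Nonempty (G ⧸ N.toSubgroup ≃* Multiplicative (ZMod 4)) ∨
      Nonempty (G ⧸ N.toSubgroup ≃* DihedralGroup 4)) ∧ s ∉ N.toSubgroup := by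
  by_cases hs2 : s ∈ descendingCentral G 2 2
  · obtain ⟨ψ, ψ', c, hc, hcs⟩ := exists_cup_cochain_of_mem_descendingCentral hG.ker_cup hs2 hs
    by_cases h : ψ = 0 ∨ ψ' = 0
    -- With zero coboundary `c` is a character and vanishes on `G⁽²⁾`.
    · refine absurd (H1.eq_zero_of_mem_descendingCentral ⟨c, fun x y => ?_⟩ hs2) hcs
      have h0 : ψ.1 x * ψ'.1 y = 0 := by
        obtain rfl | rfl := h
        · exact zero_mul _
        · exact mul_zero _
      exact (sub_eq_zero.1 ((hc x y).trans h0)).symm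
    · push Not at h
      by_cases hne : ψ = ψ'
      · subst hne
        obtain ⟨N, hN, hN'⟩ := exists_cyclic_quotient h.1 c hc
        exact ⟨N, Or.inl hN, fun h => hcs (hN' s h).2⟩
      · obtain ⟨N, hN, hN'⟩ := exists_dihedral_quotient h.1 h.2 hne c hc
        exact ⟨N, Or.inr hN, fun h => hcs (hN' s h).2.2⟩
  · exact exists_quotient_of_notMem_descendingCentral_two hG.exists_bockstein hG2 hs2

end ProfiniteCohomology

theorem corollary11p4 {G : Type*} [Group G] [TopologicalSpace G] [IsTopologicalGroup G]
    [CompactSpace G] [TotallyDisconnectedSpace G]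
    (hG : ProfiniteCohomology.IsGaloisRelationType 2 G)
    (hG2 : ¬ Nonempty (MaxProPQuotient G 2 ≃ₜ* Multiplicative (ZMod 2))) :
    descendingCentral G 2 3 =
      ⨅ (N : OpenNormalSubgroup G)
        (_ : Nonempty (G ⧸ N.toSubgroup ≃* Unit) ∨
          Nonempty (G ⧸ N.toSubgroup ≃* Multiplicative (ZMod 4)) ∨
          Nonempty (G ⧸ N.toSubgroup ≃* DihedralGroup 4)),
        N.toSubgroup := by
  refine le_antisymm (le_iInf fun N => le_iInf fun hN => ?_) fun s hs => ?_
  · obtain ⟨⟨e⟩⟩ | ⟨⟨e⟩⟩ | ⟨⟨e⟩⟩ := hN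
    · exact descendingCentral_two_three_le_of_mulEquiv N.isOpen' e (fun _ _ => rfl) fun _ => rfl
    · exact descendingCentral_two_three_le_of_mulEquiv N.isOpen' e (fun _ _ => mul_comm _ _)
        (by decide)
    · exact descendingCentral_two_three_le_of_mulEquiv N.isOpen' e (by decide) (by decide)
  · by_contra hs3
    obtain ⟨N, hN, hsN⟩ :=
      ProfiniteCohomology.exists_quotient_of_notMem_descendingCentral_three hG hG2 hs3
    exact hsN ((iInf₂_le N (Or.inr hN) : _ ≤ N.toSubgroup) hs)
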